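/- Let $d,d'\in\mathbb N$. A sliced-ReLU attention layer on tokens in $\mathbb R^m$, with $H$ heads of dimension $k$, is the map $$\Gamma_\theta(x,\mu)=x+\sum_{h=1}^{H}W^h\int\frac{\operatorname{ReLU}(\Pi^hQ^hx-\Pi^hK^hy)}{\int|\Pi^hQ^hx-\Pi^hK^hz|\,d\mu(z)}\,V^hy\,d\mu(y),$$ where $x\in\mathbb R^m$, $\mu$ is a probability measure on $\mathbb R^m$, $Q^h,K^h,V^h:\mathbb R^m\to\mathbb R^k$ are affine, and $\Pi^h:\mathbb R^k\to\mathbb R$, $W^h:\mathbb R^k\to\mathbb R^m$ are linear. We write $d_{in}(\theta)=m$, $d_{head}(\theta)=k$, $H(\theta)=H$. An MLP $F_\xi$ is a ReLU network (affine maps alternating with coordinatewise ReLU, any number of hidden layers), regarded as a context-independent map $F_\xi(x,\mu)=F_\xi(x)$. Contextual maps are composed by $(G\diamond F)(x,\mu)=G\big(F(x,\mu),F(\cdot,\mu)_\#\mu\big)$. There is a constant $w=w(d,d')$ such that the following holds. Let $\Omega\subset\mathbb R^d$ be compact, and let $\Lambda^*:\Omega\times\mathcal P(\Omega)\to\mathbb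 R^{d'}$ be continuous for the product of the $\ell^2$ topology and the weak$^*$ topology. Then for every $\varepsilon>0$ there exist a depth $L\ge1$ and parameters $(\xi_l,\theta_l)_{1\le l\le L}$ such that for all $(x,\mu)\in\Omega\times\mathcal P(\Omega)$ all normalizing integrals that occur in the evaluation at $(x,\mu)$ are positive and $$\big\|F_{\xi_L}\diamond\Gamma_{\theta_L}\diamond\cdots\diamond F_{\xi_1}\diamond\Gamma_{\theta_1}(x,\mu)-\Lambda^*(x,\mu)\big\|\le\varepsilon,$$ with $d_{in}(\theta_l)\le d+3d'$, $d_{head}(\theta_l)=1$ and $H(\theta_l)=d'$ for every $l$, and with all hidden layers of the MLPs $F_{\xi_l}$ of width at most $w$. Thus only the depth (the number $L$ of layers and the number of hidden layers in the MLPs) depends on $\varepsilon$. -/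

import Mathlib

open MeasureTheory

noncomputable section

namespace SlicedReLU

/-- The token space `ℝ^m` with its Euclidean (`ℓ²`) norm. -/
abbrev Token (m : ℕ) : Type := EuclideanSpace ℝ (Fin m)

/-- The rectifier `max(t, 0)`. -/
def relu (t : ℝ) : ℝ := max t 0

/-- The rectifier applied coordinate by coordinate. -/
def reluVec {m : ℕ} (x : Token m) : Token m := WithLp.toLp 2 fun i => relu (x i)

/-- Parameters of a ReLU multilayer perceptron `ℝ^m → ℝ^n` with any number (possibly `0`) of
hidden layers: `out A` is the affine map `A`, and `hidden A F` is `F ∘ ReLU ∘ A`, where `A` is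
affine with values in a hidden layer of width `k`. -/
inductive MLP : ℕ → ℕ → Type
  | out {m n : ℕ} (A : Token m →ᵃ[ℝ] Token n) : MLP m n
  | hidden {m k n : ℕ} (A : Token m →ᵃ[ℝ] Token k) (F : MLP k n) : MLP m n

/-- The function computed by a multilayer perceptron. -/
def MLP.eval : {m n : ℕ} → MLP m n → Token m → Token n
  | _, _, .out A, x => A x
  | _, _, .hidden A F, x => F.eval (reluVec (A x))

/-- All hidden layers of the perceptron have width at most `w`. -/
def MLP.HiddenWidthLE (w : ℕ) : {m n : ℕ} → MLP m n → Prop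
  | _, _, .out _ => True
  | _, _, .hidden (k := k) _ F => k ≤ w ∧ F.HiddenWidthLE w

/-- A contextual map `(x, μ) ↦ G(x, μ)`, where `x ∈ ℝ^m` is a token and the measure `μ` on `ℝ^m`
is its context. -/
abbrev ContextMap (m n : ℕ) : Type := Token m → Measure (Token m) → Token n

/-- Composition of contextual maps: `(G ⋄ F)(x, μ) = G(F(x, μ), F(·, μ)_# μ)`. -/
def diamond {m n p : ℕ} (G : ContextMap n p) (F : ContextMap m n) : ContextMap m p :=
  fun x μ => G (F x μ) (μ.map fun y => F y μ)

/-- Parameters of one sliced ReLU attention head on tokens in `ℝ^m` with head dimension `k`: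
affine query, key and value maps, a linear projection `Π : ℝ^k → ℝ` of queries and keys to
scores, and the linear output map that brings the values back to `ℝ^m`. -/
structure Head (m k : ℕ) where
  Q : Token m →ᵃ[ℝ] Token k
  K : Token m →ᵃ[ℝ] Token k
  V : Token m →ᵃ[ℝ] Token k
  proj : Token k →ₗ[ℝ] ℝ
  W : Token k →ₗ[ℝ] Token m

/-- The interaction `ReLU(Π Q x - Π K y)`. -/
def Head.sim {m k : ℕ} (θ : Head m k) (x y : Token m) : ℝ :=
  relu (θ.proj (θ.Q x) - θ.proj (θ.K y))

/-- The normalization `∫ |Π Q x - Π K z| dμ(z)`. -/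
def Head.norm {m k : ℕ} (θ : Head m k) (x : Token m) (μ : Measure (Token m)) : ℝ :=
  ∫ z, |θ.proj (θ.Q x) - θ.proj (θ.K z)| ∂μ

/-- Mean-field multi-head sliced ReLU attention with residual connection,
`Γ_θ(x, μ) = x + ∑_h W^h ∫ ReLU(Π Q x - Π K y) / (∫ |Π Q x - Π K z| dμ(z)) V y dμ(y)`,
where `Q`, `K`, `V`, `Π` are those of the head `h`. -/
def attention {m k H : ℕ} (θ : Fin H → Head m k) : ContextMap m m :=
  fun x μ => x + ∑ h, (θ h).W (∫ y, ((θ h).sim x y / (θ h).norm x μ) • (θ h).V y ∂μ)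

/-- Parameters of a transformer layer on tokens in `ℝ^m`, with values in `ℝ^n`, with `H` heads of
dimension `k`. -/
structure Layer (k H m n : ℕ) where
  θ : Fin H → Head m k
  ξ : MLP m n

/-- A layer computes `F_ξ ⋄ Γ_θ`: attention followed by a context-independent perceptron. -/
def Layer.eval {k H m n : ℕ} (ℓ : Layer k H m n) : ContextMap m n :=
  diamond (fun x _ => ℓ.ξ.eval x) (attention ℓ.θ)

/-- All normalizations in the attention of this layer are non-zero at `(x, μ)`, so that no division
by zero occurs there. -/
def Layer.WellDefinedAt {k H m n : ℕ} (ℓ : Layer k H m n) (x : Token m)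
    (μ : Measure (Token m)) : Prop :=
  ∀ h, 0 < (ℓ.θ h).norm x μ

/-- Parameters of a mean-field transformer `Transformer k H L m n`, with `L ≥ 1` layers, taking
tokens in `ℝ^m` to tokens in `ℝ^n`, in which every attention layer has `H` heads of dimension `k`.
The token dimensions between the layers are arbitrary. -/
inductive Transformer (k H : ℕ) : ℕ → ℕ → ℕ → Type
  | single {m n : ℕ} (ℓ : Layer k H m n) : Transformer k H 1 m n
  | snoc {L m n p : ℕ} (T : Transformer k H L m n) (ℓ : Layer k H n p) :
      Transformer k H (L + 1) m p

namespace Transformer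

variable {k H : ℕ}

/-- The contextual map `F_{ξ_L} ⋄ Γ_{θ_L} ⋄ ⋯ ⋄ F_{ξ_1} ⋄ Γ_{θ_1}` of the transformer. -/
def eval : {L m n : ℕ} → Transformer k H L m n → ContextMap m n
  | _, _, _, .single ℓ => ℓ.eval
  | _, _, _, .snoc T ℓ => diamond ℓ.eval T.eval

/-- No division by zero occurs in any layer when the transformer is evaluated at `(x, μ)`. -/
def WellDefinedAt : {L m n : ℕ} → Transformer k H L m n → Token m → Measure (Token m) → Prop
  | _, _, _, .single ℓ, x, μ => ℓ.WellDefinedAt x μ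
  | _, _, _, .snoc T ℓ, x, μ =>
      T.WellDefinedAt x μ ∧ ℓ.WellDefinedAt (T.eval x μ) (μ.map fun y => T.eval y μ)

/-- Every attention layer acts on tokens of dimension at most `D`. -/
def InputDimLE (D : ℕ) : {L m n : ℕ} → Transformer k H L m n → Prop
  | _, m, _, .single _ => m ≤ D
  | _, _, _, .snoc (n := n) T _ => T.InputDimLE D ∧ n ≤ D

/-- Every hidden layer of every perceptron of the transformer has width at most `w`. -/
def HiddenWidthLE (w : ℕ) : {L m n : ℕ} → Transformer k H L m n → Prop
  | _, _, _, .single ℓ => ℓ.ξ.HiddenWidthLE w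
  | _, _, _, .snoc T ℓ => T.HiddenWidthLE w ∧ ℓ.ξ.HiddenWidthLE w

end Transformer

end SlicedReLU

end

namespace SlicedReLU

/-! Attention is needed only for averaging: with constant scores every normalizer is 1, and a layer
adds to the token `d'` times the mean of an affine functional. So if a register holds `φ x`,
attention can turn it into `φ x + d' * ∫ φ dμ`.

Affine functions of `x` plus multiples of such expressions, with `φ` an `orthantBump`, form the
family `atoms`. It is continuous in `(x, μ)` (`continuous_atoms`) and takes prescribed values at two
prescribed points (`atoms_separate`), since integrals of orthant bumps determine a measure. The
lattice Stone–Weierstrass theorem `exists_maxMinOf_near` then approximates each coordinate of the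
target by a maximum of minima of atoms.

Such an expression is evaluated exactly with fixed memory: the input, `d'` running maxima, one
running minimum, one atom. More terms cost depth, never width (`exists_computes_maxMinOf`). -/

/-! ### Perceptrons with one hidden layer -/

lemma measurable_relu : Measurable relu := measurable_id.max measurable_const

lemma measurable_reluVec {m : ℕ} : Measurable (reluVec (m := m)) := by
  unfold reluVec
  refine (WithLp.measurable_toLp 2 _).comp (measurable_pi_lambda _ fun i => ?_)
  exact measurable_relu.comp (by fun_prop)

lemma MLP.measurable_eval : ∀ {m n : ℕ} (F : MLP m n), Measurable F.eval
  | _, _, .out A => A.continuous_of_finiteDimensional.measurable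
  | _, _, .hidden A F =>
    F.measurable_eval.comp (measurable_reluVec.comp A.continuous_of_finiteDimensional.measurable)

/-- The affine map with prescribed affine coordinates. -/
noncomputable def affineOfCoords {m n : ℕ} (f : Fin n → Token m →ᵃ[ℝ] ℝ) :
    Token m →ᵃ[ℝ] Token n :=
  (WithLp.linearEquiv 2 ℝ (Fin n → ℝ)).symm.toLinearMap.toAffineMap.comp (AffineMap.pi f)

@[simp]
lemma affineOfCoords_apply {m n : ℕ} (f : Fin n → Token m →ᵃ[ℝ] ℝ) (x : Token m) (i : Fin n) :
    affineOfCoords f x i = f i x := rfl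

/-- The `i`-th coordinate as an affine map. -/
noncomputable def coordAffine {m : ℕ} (i : Fin m) : Token m →ᵃ[ℝ] ℝ :=
  (EuclideanSpace.proj i : Token m →L[ℝ] ℝ).toLinearMap.toAffineMap

@[simp]
lemma coordAffine_apply {m : ℕ} (i : Fin m) (x : Token m) : coordAffine i x = x i := rfl

lemma relu_sub_relu_neg (t : ℝ) : relu t - relu (-t) = t := by
  unfold relu
  rcases le_total t 0 with h | h
  · rw [max_eq_right h, max_eq_left (by linarith)]; ring
  · rw [max_eq_left h, max_eq_right (by linarith)]; ring

/-- A perceptron with one hidden layer computes an affine map plus a combination of rectified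
affine functionals. -/
lemma exists_MLP_affine_add_relu {m n r : ℕ} (f : Fin n → Token m →ᵃ[ℝ] ℝ)
    (a : Fin r → Token m →ᵃ[ℝ] ℝ) (v : Fin r → Fin n → ℝ) :
    ∃ F : MLP m n, F.HiddenWidthLE (m + m + r) ∧
      ∀ x i, F.eval x i = f i x + ∑ k, v k i * relu (a k x) := by
  -- The hidden layer holds `relu (x j)`, `relu (-x j)` and `relu (a k x)`; the first two recover `x
  -- j` as a difference, hence any affine map.
  let A : Token m →ᵃ[ℝ] Token (m + m + r) := affineOfCoords
    (Fin.append (Fin.append (fun i => coordAffine i) fun i => -coordAffine i) a)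
  let g : Fin n → Token (m + m + r) →ᵃ[ℝ] ℝ := fun i =>
    AffineMap.const ℝ _ (f i 0) +
      ∑ j : Fin m, (f i).linear (EuclideanSpace.single j 1) •
        (coordAffine (Fin.castAdd r (Fin.castAdd m j)) -
          coordAffine (Fin.castAdd r (Fin.natAdd m j))) +
      ∑ k, v k i • coordAffine (Fin.natAdd (m + m) k)
  have hsum : ∀ {ι : Type} (s : Finset ι) (h : ι → Token (m + m + r) →ᵃ[ℝ] ℝ)
      (y : Token (m + m + r)), (∑ j ∈ s, h j) y = ∑ j ∈ s, h j y := by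
    classical
    intro ι s h y
    induction s using Finset.induction_on with
    | empty => simp
    | insert j s hj ih => simp [Finset.sum_insert hj, ih]
  refine ⟨.hidden A (.out (affineOfCoords g)), ⟨le_rfl, trivial⟩, fun x i => ?_⟩
  have hf : f i x = f i 0 + ∑ j, (f i).linear (EuclideanSpace.single j 1) * x j := by
    have h1 : f i x = (f i).linear x + f i 0 := congrFun (f i).decomp x
    have h2 : x = ∑ j, x j • EuclideanSpace.single j (1 : ℝ) := by
      ext j
      simp [Finset.sum_apply, Pi.single_apply]
    rw [h1]
    conv_lhs => rw [h2]
    simp only [map_sum, map_smul, smul_eq_mul]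
    rw [add_comm]
    simp only [mul_comm]
  rw [hf]
  simp only [MLP.eval, affineOfCoords_apply, g, AffineMap.coe_add, hsum, AffineMap.coe_smul,
    Pi.add_apply, Pi.smul_apply, Pi.sub_apply, Pi.neg_apply, AffineMap.const_apply, AffineMap.coe_sub, coordAffine_apply, smul_eq_mul, reluVec, A,
    Fin.append_left, Fin.append_right, AffineMap.coe_neg, relu_sub_relu_neg]

/-! ### Averaging by attention -/

/-- A head with constant scores, which averages the affine functional `f` and writes the result
in the direction `u`. -/
noncomputable def meanHead {m : ℕ} (f : Token m →ᵃ[ℝ] ℝ) (u : Token m) : Head m 1 where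
  Q := AffineMap.const ℝ _ (EuclideanSpace.single 0 1)
  K := AffineMap.const ℝ _ 0
  V := affineOfCoords fun _ => f
  proj := (EuclideanSpace.proj 0 : Token 1 →L[ℝ] ℝ).toLinearMap
  W := (EuclideanSpace.proj 0 : Token 1 →L[ℝ] ℝ).toLinearMap.smulRight u

lemma meanHead_norm {m : ℕ} (f : Token m →ᵃ[ℝ] ℝ) (u x : Token m) (μ : Measure (Token m))
    [IsProbabilityMeasure μ] : (meanHead f u).norm x μ = 1 := by
  simp [Head.norm, meanHead]

lemma meanHead_sim {m : ℕ} (f : Token m →ᵃ[ℝ] ℝ) (u x y : Token m) :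
    (meanHead f u).sim x y = 1 := by
  simp [Head.sim, meanHead, relu]

/-- All heads are equal, so their outputs add up; this is the origin of the factor `d'` in the
atoms. -/
lemma attention_meanHead {m H : ℕ} (f : Token m →ᵃ[ℝ] ℝ) (u x : Token m) (μ : Measure (Token m))
    [IsProbabilityMeasure μ] :
    attention (fun _ : Fin H => meanHead f u) x μ = x + ((H : ℝ) * ∫ y, f y ∂μ) • u := by
  have hV : (∫ y, (meanHead f u).V y ∂μ) 0 = ∫ y, f y ∂μ := by
    have h : (∫ y, (meanHead f u).V y ∂μ) = EuclideanSpace.single 0 (∫ y, f y ∂μ) := by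
      let E : ℝ ≃L[ℝ] Token 1 :=
        LinearEquiv.toContinuousLinearEquiv
          { toFun := fun t => EuclideanSpace.single 0 t
            map_add' := fun s t => by ext i; fin_cases i; simp
            map_smul' := fun s t => by ext i; fin_cases i; simp
            invFun := fun v => v 0
            left_inv := fun t => by simp
            right_inv := fun v => by ext i; fin_cases i; simp }
      have hE : ∀ y, (meanHead f u).V y = E (f y) := by
        intro y
        ext i
        fin_cases i
        simp [meanHead, E]
      simp only [hE]
      rw [E.integral_comp_comm]
      rfl
    rw [h]
    simp
  have hW : ∀ t : Token 1, (meanHead f u).W t = t 0 • u := fun t => rfl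
  simp only [attention, meanHead_norm, meanHead_sim, div_one, one_smul, hW, hV, Finset.sum_const,
    Finset.card_univ, Fintype.card_fin]
  rw [← Nat.cast_smul_eq_nsmul ℝ, smul_smul]

/-! ### Exact computation with registers -/

/-- Names for the coordinates of a state token: the input token, `d'` registers for the output,
and two auxiliary registers. -/
abbrev Reg (d d' : ℕ) : Type := Fin d ⊕ (Fin d' ⊕ Fin 2)

/-- The numbering of the registers. -/
def regEquiv (d d' : ℕ) : Reg d d' ≃ Fin (d + (d' + 2)) :=
  ((Equiv.refl _).sumCongr finSumFinEquiv).trans finSumFinEquiv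

/-- A state token as a function of the register. -/
noncomputable def regs (d d' : ℕ) : Token (d + (d' + 2)) →ᵃ[ℝ] (Reg d d' → ℝ) :=
  AffineMap.pi fun i => coordAffine (regEquiv d d' i)

/-- The bound for the widths of the hidden layers. -/
def widthBound (d d' : ℕ) : ℕ := (d + (d' + 2)) + (d + (d' + 2)) + (d + 1)

lemma MLP.HiddenWidthLE.mono {w w' : ℕ} (hw : w ≤ w') : ∀ {m n : ℕ} {F : MLP m n},
    F.HiddenWidthLE w → F.HiddenWidthLE w'
  | _, _, .out _, _ => trivial
  | _, _, .hidden _ _, h => ⟨h.1.trans hw, h.2.mono hw⟩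

/-- The register contents `G`, as functions of the input token and of the context, are computed
exactly by some transformer. -/
def Computes {d d' : ℕ} (G : Reg d d' → Token d → Measure (Token d) → ℝ) : Prop :=
  ∃ (L : ℕ) (T : Transformer 1 d' L d (d + (d' + 2))),
    T.InputDimLE (d + 3 * d') ∧ T.HiddenWidthLE (widthBound d d') ∧
    ∀ μ : Measure (Token d), IsProbabilityMeasure μ →
      Measurable (fun x => T.eval x μ) ∧
      ∀ x, T.WellDefinedAt x μ ∧ ∀ i, T.eval x μ (regEquiv d d' i) = G i x μ

/-- The layer that averages `f` in the direction `u` and then applies the perceptron `F`. -/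
noncomputable def meanLayer {m n : ℕ} (H : ℕ) (f : Token m →ᵃ[ℝ] ℝ) (u : Token m) (F : MLP m n) :
    Layer 1 H m n where
  θ := fun _ => meanHead f u
  ξ := F

lemma meanLayer_eval {m n H : ℕ} (f : Token m →ᵃ[ℝ] ℝ) (u : Token m) (F : MLP m n)
    (x : Token m) (μ : Measure (Token m)) [IsProbabilityMeasure μ] :
    (meanLayer H f u F).eval x μ = F.eval (x + ((H : ℝ) * ∫ y, f y ∂μ) • u) := by
  rw [← attention_meanHead]
  rfl

lemma meanLayer_wellDefinedAt {m n H : ℕ} (f : Token m →ᵃ[ℝ] ℝ) (u : Token m) (F : MLP m n)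
    (x : Token m) (μ : Measure (Token m)) [IsProbabilityMeasure μ] :
    (meanLayer H f u F).WellDefinedAt x μ := by
  intro h
  change 0 < (meanHead f u).norm x μ
  rw [meanHead_norm]
  exact one_pos

section Computes

variable {d d' : ℕ}

lemma computes_init (d d' : ℕ) : Computes (d := d) (d' := d')
    (Sum.elim (fun i x _ => x i) fun _ _ _ => 0) := by
  let F : MLP d (d + (d' + 2)) := .out (affineOfCoords fun k =>
    Sum.elim (fun i => coordAffine i) (fun _ => 0) ((regEquiv d d').symm k))
  refine ⟨1, .single (meanLayer d' 0 0 F), Nat.le_add_right _ _, trivial, fun μ hμ => ?_⟩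
  have he : ∀ x, (Transformer.single (meanLayer d' 0 0 F)).eval x μ = F.eval x := by
    intro x
    change (meanLayer d' 0 0 F).eval x μ = _
    rw [meanLayer_eval]
    simp
  refine ⟨by simpa only [he] using F.measurable_eval, fun x =>
    ⟨meanLayer_wellDefinedAt _ _ _ _ _, fun i => ?_⟩⟩
  rw [he]
  rcases i with i | i <;> simp [F, MLP.eval]

/-- Appending a layer to a transformer that computes `G`. -/
lemma snoc_spec {L n : ℕ} {G : Reg d d' → Token d → Measure (Token d) → ℝ}
    (T : Transformer 1 d' L d (d + (d' + 2))) (μ : Measure (Token d)) [IsProbabilityMeasure μ]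
    (hm : Measurable fun x => T.eval x μ)
    (hT : ∀ x, T.WellDefinedAt x μ ∧ ∀ i, T.eval x μ (regEquiv d d' i) = G i x μ)
    (i₀ : Reg d d') (u : Token (d + (d' + 2))) (F : MLP (d + (d' + 2)) n) :
    Measurable (fun x => (T.snoc (meanLayer d' (coordAffine (regEquiv d d' i₀)) u F)).eval x μ) ∧
    ∀ x, (T.snoc (meanLayer d' (coordAffine (regEquiv d d' i₀)) u F)).WellDefinedAt x μ ∧
      (T.snoc (meanLayer d' (coordAffine (regEquiv d d' i₀)) u F)).eval x μ =
        F.eval (T.eval x μ + ((d' : ℝ) * ∫ y, G i₀ y μ ∂μ) • u) := by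
  -- Measurability of the state is carried along for this: only a context of total mass 1 gives the
  -- new heads normalizer 1.
  have : IsProbabilityMeasure (μ.map fun y => T.eval y μ) :=
    Measure.isProbabilityMeasure_map hm.aemeasurable
  have he : ∀ x, (T.snoc (meanLayer d' (coordAffine (regEquiv d d' i₀)) u F)).eval x μ =
        F.eval (T.eval x μ + ((d' : ℝ) * ∫ y, G i₀ y μ ∂μ) • u) := by
    intro x
    change (meanLayer d' (coordAffine (regEquiv d d' i₀)) u F).eval (T.eval x μ)
      (μ.map fun y => T.eval y μ) = _
    rw [meanLayer_eval, integral_map hm.aemeasurable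
      (coordAffine (regEquiv d d' i₀)).continuous_of_finiteDimensional.aestronglyMeasurable]
    simp only [coordAffine_apply, (hT _).2]
  refine ⟨?_, fun x => ⟨⟨(hT x).1, meanLayer_wellDefinedAt _ _ _ _ _⟩, he x⟩⟩
  simp only [he]
  exact F.measurable_eval.comp (hm.add_const _)

/-- Replacing the content of a register by an affine functional of all registers plus a combination
of rectified affine functionals. -/
lemma Computes.update_relu (hd' : 0 < d') {r : ℕ} (hr : r ≤ d + 1)
    {G : Reg d d' → Token d → Measure (Token d) → ℝ} (hG : Computes G) (i₀ : Reg d d')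
    (A : (Reg d d' → ℝ) →ᵃ[ℝ] ℝ) (a : Fin r → (Reg d d' → ℝ) →ᵃ[ℝ] ℝ) (v : Fin r → ℝ) :
    Computes (Function.update G i₀ fun x μ =>
      A (fun i => G i x μ) + ∑ k, v k * relu (a k fun i => G i x μ)) := by
  obtain ⟨L, T, hin, hw, hT⟩ := hG
  obtain ⟨F, hF, hFe⟩ := exists_MLP_affine_add_relu
    (fun k => if k = regEquiv d d' i₀ then A.comp (regs d d') else coordAffine k)
    (fun k => (a k).comp (regs d d'))
    (fun j k => if k = regEquiv d d' i₀ then v j else 0)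
  -- Direction `0` switches attention off. The state dimension `d + (d' + 2)` is at most `d + 3 *
  -- d'` because `d' ≥ 1`.
  refine ⟨L + 1, T.snoc (meanLayer d' (coordAffine (regEquiv d d' i₀)) 0 F),
    ⟨hin, by omega⟩, ⟨hw, hF.mono (by unfold widthBound; omega)⟩, fun μ hμ => ?_⟩
  obtain ⟨h1, h2⟩ := snoc_spec T μ (hT μ hμ).1 (hT μ hμ).2 i₀ 0 F
  refine ⟨h1, fun x => ⟨(h2 x).1, fun i => ?_⟩⟩
  have hx : regs d d' (T.eval x μ) = fun i => G i x μ := by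
    ext i
    exact ((hT μ hμ).2 x).2 i
  rw [(h2 x).2, hFe]
  simp only [smul_zero, add_zero, AffineMap.comp_apply, hx]
  by_cases hi : i = i₀
  · subst hi
    simp [hx]
  · simp [hi, ((hT μ hμ).2 x).2 i]

/-- Adding to a register a multiple of its mean over the context. -/
lemma Computes.update_mean (hd' : 0 < d')
    {G : Reg d d' → Token d → Measure (Token d) → ℝ} (hG : Computes G) (i₀ : Reg d d') :
    Computes (Function.update G i₀ fun x μ => G i₀ x μ + d' * ∫ y, G i₀ y μ ∂μ) := by
  obtain ⟨L, T, hin, hw, hT⟩ := hG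
  let F : MLP (d + (d' + 2)) (d + (d' + 2)) := .out (AffineMap.id ℝ _)
  refine ⟨L + 1, T.snoc (meanLayer d' (coordAffine (regEquiv d d' i₀))
    (EuclideanSpace.single (regEquiv d d' i₀) 1) F), ⟨hin, by omega⟩, ⟨hw, trivial⟩,
    fun μ hμ => ?_⟩
  obtain ⟨h1, h2⟩ := snoc_spec T μ (hT μ hμ).1 (hT μ hμ).2 i₀
    (EuclideanSpace.single (regEquiv d d' i₀) 1) F
  refine ⟨h1, fun x => ⟨(h2 x).1, fun i => ?_⟩⟩
  rw [(h2 x).2]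
  by_cases hi : i = i₀
  · subst hi
    simp [F, MLP.eval, ((hT μ hμ).2 x).2]
  · simp [hi, F, MLP.eval, ((hT μ hμ).2 x).2]

/-- Reading the output registers. -/
lemma Computes.exists_transformer (hd' : 0 < d')
    {G : Reg d d' → Token d → Measure (Token d) → ℝ} (hG : Computes G) :
    ∃ (L : ℕ) (T : Transformer 1 d' L d d'),
      T.InputDimLE (d + 3 * d') ∧ T.HiddenWidthLE (widthBound d d') ∧
      ∀ μ : Measure (Token d), IsProbabilityMeasure μ → ∀ x, T.WellDefinedAt x μ ∧
        ∀ j, T.eval x μ j = G (.inr (.inl j)) x μ := by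
  obtain ⟨L, T, hin, hw, hT⟩ := hG
  let F : MLP (d + (d' + 2)) d' :=
    .out (affineOfCoords fun j => coordAffine (regEquiv d d' (.inr (.inl j))))
  refine ⟨L + 1, T.snoc (meanLayer d' (coordAffine (regEquiv d d' (.inr (.inr 0)))) 0 F),
    ⟨hin, by omega⟩, ⟨hw, trivial⟩, fun μ hμ x => ?_⟩
  have h := (snoc_spec T μ (hT μ hμ).1 (hT μ hμ).2 (.inr (.inr 0)) 0 F).2 x
  refine ⟨h.1, fun j => ?_⟩
  rw [h.2]
  simp [F, MLP.eval, ((hT μ hμ).2 x).2]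

end Computes

/-! ### Lattice form of Stone–Weierstrass -/

/-- Functions `min (a₁, …, aₙ, c)` with `aᵢ ∈ 𝒜`. -/
inductive MinOf {Y : Type*} (𝒜 : Set (Y → ℝ)) : (Y → ℝ) → Prop
  | const (c : ℝ) : MinOf 𝒜 fun _ => c
  | min {f a : Y → ℝ} : MinOf 𝒜 f → a ∈ 𝒜 → MinOf 𝒜 fun y => min (f y) (a y)

/-- Functions `max (f₁, …, fₙ, c)`, where the `fᵢ` are minima of members of `𝒜`. -/
inductive MaxMinOf {Y : Type*} (𝒜 : Set (Y → ℝ)) : (Y → ℝ) → Prop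
  | const (c : ℝ) : MaxMinOf 𝒜 fun _ => c
  | max {g f : Y → ℝ} : MaxMinOf 𝒜 g → MinOf 𝒜 f → MaxMinOf 𝒜 fun y => max (g y) (f y)

section Lattice

variable {X Y : Type*} {𝒜 : Set (Y → ℝ)}

lemma MinOf.continuous_comp [TopologicalSpace X] {ι : X → Y}
    (h𝒜 : ∀ a ∈ 𝒜, Continuous fun x => a (ι x)) {f : Y → ℝ} (hf : MinOf 𝒜 f) :
    Continuous fun x => f (ι x) := by
  induction hf with
  | const c => exact continuous_const
  | min _ ha ih => exact ih.min (h𝒜 _ ha)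

/-- The minimum starts from the constant `C`, whence the condition `r ≤ C`. -/
lemma exists_minOf_finset {κ : Type*} (t : Finset κ) (a : κ → Y → ℝ) (ha : ∀ k, a k ∈ 𝒜) (C : ℝ) :
    ∃ f, MinOf 𝒜 f ∧ (∀ k ∈ t, ∀ y, f y ≤ a k y) ∧
      ∀ y r, r ≤ C → (∀ k, r ≤ a k y) → r ≤ f y := by
  classical
  induction t using Finset.induction_on with
  | empty => exact ⟨_, .const C, by simp, fun y r hr _ => hr⟩
  | insert k t hk ih =>
    obtain ⟨f, hf, h1, h2⟩ := ih
    refine ⟨_, hf.min (ha k), fun l hl y => ?_, fun y r hr h => le_min (h2 y r hr h) (h k)⟩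
    rcases Finset.mem_insert.1 hl with rfl | hl
    · exact min_le_right _ _
    · exact (min_le_left _ _).trans (h1 l hl y)

lemma exists_maxMinOf_finset {κ : Type*} (t : Finset κ) (f : κ → Y → ℝ) (hf : ∀ k, MinOf 𝒜 (f k))
    (c : ℝ) :
    ∃ g, MaxMinOf 𝒜 g ∧ (∀ k ∈ t, ∀ y, f k y ≤ g y) ∧
      ∀ y r, c ≤ r → (∀ k, f k y ≤ r) → g y ≤ r := by
  classical
  induction t using Finset.induction_on with
  | empty => exact ⟨_, .const c, by simp, fun y r hr _ => hr⟩
  | insert k t hk ih =>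
    obtain ⟨g, hg, h1, h2⟩ := ih
    refine ⟨_, hg.max (hf k), fun l hl y => ?_, fun y r hr h => max_le (h2 y r hr h) (h k)⟩
    rcases Finset.mem_insert.1 hl with rfl | hl
    · exact le_max_right _ _
    · exact (h1 l hl y).trans (le_max_left _ _)

/-- The lattice form of the Stone–Weierstrass theorem, for maxima of minima. -/
theorem exists_maxMinOf_near [TopologicalSpace X] [CompactSpace X] {ι : X → Y}
    (h𝒜 : ∀ a ∈ 𝒜, Continuous fun x => a (ι x))
    (hsep : ∀ z w : X, ∀ r s : ℝ, (z = w → r = s) → ∃ a ∈ 𝒜, a (ι z) = r ∧ a (ι w) = s)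
    {f : X → ℝ} (hf : Continuous f) {ε : ℝ} (hε : 0 < ε) :
    ∃ g, MaxMinOf 𝒜 g ∧ ∀ x, |g (ι x) - f x| ≤ ε := by
  -- Starting minima at an upper bound of `f` and the maximum at a lower bound keeps these constants
  -- from spoiling the estimates.
  obtain ⟨C, hC⟩ := (isCompact_range hf).bddAbove
  obtain ⟨c, hc⟩ := (isCompact_range hf).bddBelow
  -- For fixed `z`, take for each `w` a member of `𝒜` agreeing with `f` at `z` and `w`. It is below
  -- `f + ε` near `w`; finitely many such neighbourhoods cover.
  have inner : ∀ z, ∃ h, MinOf 𝒜 h ∧ f z ≤ h (ι z) ∧ ∀ x, h (ι x) ≤ f x + ε := by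
    intro z
    choose a ha haz haw using fun w => hsep z w (f z) (f w) fun h => congrArg f h
    obtain ⟨t, ht⟩ := isCompact_univ.elim_finite_subcover
      (fun w => {x | a w (ι x) < f x + ε})
      (fun w => isOpen_lt (h𝒜 _ (ha w)) (hf.add continuous_const))
      (fun x _ => Set.mem_iUnion.2 ⟨x, by simp [haw x, hε]⟩)
    obtain ⟨h, hh, h1, h2⟩ := exists_minOf_finset t a ha C
    refine ⟨h, hh, h2 _ _ (hC ⟨z, rfl⟩) fun w => (haz w).ge, fun x => ?_⟩
    obtain ⟨w, hw, hx⟩ := Set.mem_iUnion₂.1 (ht (Set.mem_univ x))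
    exact (h1 w hw _).trans (le_of_lt hx)
  choose h hh hz hle using inner
  obtain ⟨t, ht⟩ := isCompact_univ.elim_finite_subcover
    (fun z => {x | f x - ε < h z (ι x)})
    (fun z => isOpen_lt (hf.sub continuous_const) ((hh z).continuous_comp h𝒜))
    (fun x _ => Set.mem_iUnion.2 ⟨x, by
      have := hz x
      simp only [Set.mem_ofPred_eq]
      linarith⟩)
  obtain ⟨g, hg, h1, h2⟩ := exists_maxMinOf_finset t h hh c
  refine ⟨g, hg, fun x => abs_le.2 ⟨?_, ?_⟩⟩
  · obtain ⟨z, hz', hx⟩ := Set.mem_iUnion₂.1 (ht (Set.mem_univ x))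
    have hx' : f x - ε < h z (ι x) := hx
    linarith [h1 z hz' (ι x)]
  · have := h2 (ι x) (f x + ε) (by linarith [hc ⟨x, rfl⟩]) fun z => hle z x
    linarith

end Lattice

/-! ### Orthant bumps determine probability measures -/

/-- A continuous approximation of the indicator function of the orthant `{x | ∀ i, xᵢ ≤ bᵢ}`. -/
noncomputable def orthantBump {d : ℕ} (n : ℝ) (b : Fin d → ℝ) (x : Token d) : ℝ :=
  relu (1 + ∑ i, -n * relu (x i - b i))

lemma continuous_relu : Continuous relu := continuous_id.max continuous_const

lemma relu_nonneg (t : ℝ) : 0 ≤ relu t := le_max_right _ _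

lemma continuous_orthantBump {d : ℕ} (n : ℝ) (b : Fin d → ℝ) : Continuous (orthantBump n b) := by
  unfold orthantBump
  refine continuous_relu.comp (continuous_const.add (continuous_finsetSum _ fun i _ =>
    continuous_const.mul (continuous_relu.comp ?_)))
  fun_prop

lemma orthantBump_nonneg {d : ℕ} (n : ℝ) (b : Fin d → ℝ) (x : Token d) : 0 ≤ orthantBump n b x :=
  relu_nonneg _

lemma orthantBump_le_one {d : ℕ} {n : ℝ} (hn : 0 ≤ n) (b : Fin d → ℝ) (x : Token d) :
    orthantBump n b x ≤ 1 := by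
  refine max_le ?_ zero_le_one
  have : ∑ i, -n * relu (x i - b i) ≤ 0 := Finset.sum_nonpos fun i _ =>
    mul_nonpos_of_nonpos_of_nonneg (by linarith) (relu_nonneg _)
  linarith

/-- The orthant of the points that lie coordinatewise below `b`. -/
def orthant {d : ℕ} (b : Fin d → ℝ) : Set (Token d) := {x | ∀ i, x i ≤ b i}

lemma measurableSet_orthant {d : ℕ} (b : Fin d → ℝ) : MeasurableSet (orthant b) := by
  unfold orthant
  rw [Set.ofPred_forall]
  exact MeasurableSet.iInter fun i => measurableSet_le (by fun_prop) measurable_const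

/-- The sequence is eventually constant: it is 1 on the orthant, and if some `x i` exceeds `b i` it
vanishes once `n ≥ 1 / (x i - b i)`. -/
lemma tendsto_orthantBump {d : ℕ} (b : Fin d → ℝ) (x : Token d) :
    Filter.Tendsto (fun n : ℕ => orthantBump n b x) Filter.atTop
      (nhds ((orthant b).indicator (fun _ => (1 : ℝ)) x)) := by
  by_cases hx : x ∈ orthant b
  · have h : ∀ n : ℕ, orthantBump n b x = 1 := by
      intro n
      have : ∀ i, relu (x i - b i) = 0 := fun i => max_eq_right (sub_nonpos.2 (hx i))
      simp only [orthantBump, this, mul_zero, Finset.sum_const_zero, add_zero]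
      exact max_eq_left zero_le_one
    simp [h, hx]
  · rw [Set.indicator_of_notMem hx]
    have hx' : ¬ ∀ i, x i ≤ b i := hx
    push Not at hx'
    obtain ⟨i, hi⟩ := hx'
    obtain ⟨N, hN⟩ := exists_nat_ge (1 / (x i - b i))
    refine tendsto_const_nhds.congr' ?_
    filter_upwards [Filter.eventually_ge_atTop N] with n hn
    symm
    refine max_eq_right ?_
    have h1 : (1 : ℝ) ≤ n * (x i - b i) := by
      have : 1 / (x i - b i) ≤ (n : ℝ) := hN.trans (by exact_mod_cast hn)
      rwa [div_le_iff₀ (sub_pos.2 hi)] at this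
    have h2 : n * (x i - b i) ≤ ∑ j, (n : ℝ) * relu (x j - b j) := by
      refine le_trans ?_ (Finset.single_le_sum (f := fun j => (n : ℝ) * relu (x j - b j))
        (fun j _ => mul_nonneg (Nat.cast_nonneg n) (relu_nonneg _)) (Finset.mem_univ i))
      exact mul_le_mul_of_nonneg_left (le_max_left _ _) (Nat.cast_nonneg n)
    simp only [neg_mul, Finset.sum_neg_distrib]
    linarith

/-- Probability measures that agree on all orthants are equal. -/
lemma measure_ext_of_orthant {d : ℕ} {μ ν : Measure (Token d)} [IsProbabilityMeasure μ]
    [IsProbabilityMeasure ν] (h : ∀ b, μ (orthant b) = ν (orthant b)) : μ = ν := by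
  -- In the product space orthants are boxes of half-lines `Iic`, a π-system generating the product
  -- σ-algebra.
  let e := (MeasurableEquiv.toLp 2 (Fin d → ℝ)).symm
  have he : ∀ b : Fin d → ℝ, e ⁻¹' (Set.pi Set.univ fun i => Set.Iic (b i)) = orthant b := by
    intro b
    ext x
    simp [orthant, e, Pi.le_def]
  have hmap : μ.map e = ν.map e := by
    have : IsProbabilityMeasure (μ.map e) :=
      Measure.isProbabilityMeasure_map e.measurable.aemeasurable
    have : IsProbabilityMeasure (ν.map e) :=
      Measure.isProbabilityMeasure_map e.measurable.aemeasurable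
    refine ext_of_generate_finite
      (Set.pi Set.univ '' Set.pi Set.univ fun _ : Fin d => Set.range (Set.Iic : ℝ → Set ℝ))
      (generateFrom_eq_pi (C := fun _ : Fin d => Set.range (Set.Iic : ℝ → Set ℝ))
        (fun _ => ?_) (fun _ => ?_)).symm
      (IsPiSystem.pi fun _ => ?_) ?_ (by simp)
    · rw [BorelSpace.measurable_eq (α := ℝ), borel_eq_generateFrom_Iic]
    · refine ⟨fun n => Set.Iic (n : ℝ), fun n => ⟨_, rfl⟩, ?_⟩
      refine Set.eq_univ_of_forall fun x => Set.mem_iUnion.2 ?_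
      exact exists_nat_ge x
    · exact isPiSystem_Iic
    · rintro s ⟨t, ht, rfl⟩
      choose b hb using fun i => ht i (Set.mem_univ i)
      obtain rfl : (fun i => Set.Iic (b i)) = t := funext hb
      have hms : MeasurableSet (Set.pi Set.univ fun i => Set.Iic (b i)) :=
        MeasurableSet.univ_pi fun i => measurableSet_Iic
      rw [Measure.map_apply e.measurable hms, Measure.map_apply e.measurable hms, he, h]
  exact e.map_measurableEquiv_injective hmap

/-- The integrals of the functions `orthantBump` determine a probability measure. -/
lemma measure_ext_of_integral_orthantBump {d : ℕ} {μ ν : Measure (Token d)}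
    [IsProbabilityMeasure μ] [IsProbabilityMeasure ν]
    (h : ∀ (n : ℕ) b, ∫ x, orthantBump n b x ∂μ = ∫ x, orthantBump n b x ∂ν) : μ = ν := by
  have lim : ∀ (ρ : Measure (Token d)) [IsProbabilityMeasure ρ] (b : Fin d → ℝ),
      Filter.Tendsto (fun n : ℕ => ∫ x, orthantBump n b x ∂ρ) Filter.atTop
        (nhds (ρ.real (orthant b))) := by
    intro ρ _ b
    have := tendsto_integral_of_dominated_convergence (μ := ρ)
      (F := fun (n : ℕ) x => orthantBump n b x) (fun _ => (1 : ℝ))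
      (fun n => (continuous_orthantBump n b).aestronglyMeasurable) (integrable_const _)
      (fun n => Filter.Eventually.of_forall fun x => by
        rw [Real.norm_of_nonneg (orthantBump_nonneg _ _ _)]
        exact orthantBump_le_one n.cast_nonneg b x)
      (Filter.Eventually.of_forall fun x => tendsto_orthantBump b x)
    rwa [integral_indicator_const _ (measurableSet_orthant b), smul_eq_mul, mul_one] at this
  refine measure_ext_of_orthant fun b => ?_
  have := tendsto_nhds_unique (lim μ b) (by simpa only [h] using lim ν b)
  exact (measureReal_eq_measureReal_iff).1 this

/-! ### Atoms: continuity and interpolation at two points -/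

/-- The functions `(x, μ) ↦ A x + c (φ x + κ ∫ φ dμ)`, with `A` affine and `φ` an
`orthantBump`. -/
def atoms (d : ℕ) (κ : ℝ) : Set (Token d × Measure (Token d) → ℝ) :=
  {a | ∃ (A : Token d →ᵃ[ℝ] ℝ) (c : ℝ) (n : ℕ) (b : Fin d → ℝ), a = fun z =>
    A z.1 + c * (orthantBump n b z.1 + κ * ∫ y, orthantBump n b y ∂z.2)}

variable {d : ℕ} {Ω : Set (Token d)}

/-- A token and a context in `Ω`, regarded as a token and a context in the ambient space. -/
noncomputable def inclusion (z : Ω × ProbabilityMeasure Ω) : Token d × Measure (Token d) :=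
  (z.1, (z.2 : Measure Ω).map Subtype.val)

lemma isProbabilityMeasure_map_val (μ : ProbabilityMeasure Ω) :
    IsProbabilityMeasure ((μ : Measure Ω).map Subtype.val) :=
  Measure.isProbabilityMeasure_map measurable_subtype_coe.aemeasurable

/-- The integral over the pushforward is that of a bounded continuous function on `Ω`, hence weakly
continuous in the measure. -/
lemma continuous_atoms {κ : ℝ} : ∀ a ∈ atoms d κ,
    Continuous fun z : Ω × ProbabilityMeasure Ω => a (inclusion z) := by
  rintro _ ⟨A, c, n, b, rfl⟩
  have hint : Continuous fun μ : ProbabilityMeasure Ω =>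
      ∫ y, orthantBump n b y ∂((μ : Measure Ω).map Subtype.val) := by
    let φ : BoundedContinuousFunction Ω ℝ := BoundedContinuousFunction.ofNormedAddCommGroup
      (fun y : Ω => orthantBump n b y) ((continuous_orthantBump n b).comp continuous_subtype_val) 1
      (fun y => by
        rw [Real.norm_of_nonneg (orthantBump_nonneg _ _ _)]
        exact orthantBump_le_one n.cast_nonneg b y)
    have := ProbabilityMeasure.continuous_integral_boundedContinuousFunction φ
    convert this using 2 with μ
    rw [integral_map measurable_subtype_coe.aemeasurable
      (continuous_orthantBump n b).aestronglyMeasurable]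
    rfl
  have h1 : Continuous fun z : Ω × ProbabilityMeasure Ω => (z.1 : Token d) :=
    continuous_subtype_val.comp continuous_fst
  exact (A.continuous_of_finiteDimensional.comp h1).add (continuous_const.mul
    (((continuous_orthantBump n b).comp h1).add (continuous_const.mul (hint.comp continuous_snd))))

/-- Distinct tokens are handled by an affine function of a differing coordinate. For equal tokens
the terms in `x` cancel in the difference, and some bump has different integrals against the two
measures; pushing forward from `Ω` loses nothing, as the inclusion is a measurable embedding. -/
lemma atoms_separate {κ : ℝ} (hκ : κ ≠ 0) (hΩ : MeasurableSet Ω)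
    (z w : Ω × ProbabilityMeasure Ω) (r s : ℝ) (h : z = w → r = s) :
    ∃ a ∈ atoms d κ, a (inclusion z) = r ∧ a (inclusion w) = s := by
  obtain ⟨x, μ⟩ := z
  obtain ⟨y, ν⟩ := w
  by_cases hxy : x = y
  · subst hxy
    by_cases hμν : μ = ν
    · subst hμν
      refine ⟨_, ⟨AffineMap.const ℝ _ r, 0, 0, 0, rfl⟩, ?_, ?_⟩
      · simp
      · simpa using h rfl
    · have hne : (μ : Measure Ω).map Subtype.val ≠ (ν : Measure Ω).map Subtype.val := by
        intro hm
        apply hμν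
        apply Subtype.ext
        have := congrArg (Measure.comap (Subtype.val : Ω → Token d)) hm
        rwa [(MeasurableEmbedding.subtype_coe hΩ).comap_map,
          (MeasurableEmbedding.subtype_coe hΩ).comap_map] at this
      have := isProbabilityMeasure_map_val μ
      have := isProbabilityMeasure_map_val ν
      have hex : ∃ (n : ℕ) (b : Fin d → ℝ),
          ∫ t, orthantBump n b t ∂((μ : Measure Ω).map Subtype.val)
            ≠ ∫ t, orthantBump n b t ∂((ν : Measure Ω).map Subtype.val) := by
        by_contra! hc
        exact hne (measure_ext_of_integral_orthantBump hc)
      obtain ⟨n, b, hnb⟩ := hex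
      set I := ∫ t, orthantBump n b t ∂((μ : Measure Ω).map Subtype.val) with hI
      set J := ∫ t, orthantBump n b t ∂((ν : Measure Ω).map Subtype.val) with hJ
      have hIJ : κ * (J - I) ≠ 0 := mul_ne_zero hκ (sub_ne_zero.2 hnb.symm)
      -- The two values of the atom differ by `c * κ * (J - I)`, which fixes `c`; the constant then
      -- matches `r` at the first point.
      refine ⟨_, ⟨AffineMap.const ℝ _ (r - (s - r) / (κ * (J - I)) *
        (orthantBump n b x + κ * I)), (s - r) / (κ * (J - I)), n, b, rfl⟩, ?_, ?_⟩
      · simp only [inclusion, AffineMap.const_apply, ← hI]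
        ring
      · simp only [inclusion, AffineMap.const_apply, ← hJ]
        have : (s - r) / (κ * (J - I)) * (κ * (J - I)) = s - r := div_mul_cancel₀ _ hIJ
        linear_combination this
  · have hex : ∃ i, (x : Token d) i ≠ (y : Token d) i := by
      by_contra! hc
      exact hxy (Subtype.ext (by ext i; exact hc i))
    obtain ⟨i, hi⟩ := hex
    have hi' : (y : Token d) i - (x : Token d) i ≠ 0 := sub_ne_zero.2 hi.symm
    refine ⟨_, ⟨AffineMap.const ℝ _ r + ((s - r) / ((y : Token d) i - (x : Token d) i)) •
      (coordAffine i - AffineMap.const ℝ _ ((x : Token d) i)), 0, 0, 0, rfl⟩, ?_, ?_⟩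
    · simp [inclusion]
    · simp [inclusion, div_mul_cancel₀ _ hi']

/-! ### Evaluating maxima of minima in the registers -/

section Registers

variable {d d' : ℕ}

/-- Updating a running minimum, or in `add_relu_sub` a running maximum, costs one rectifier. -/
lemma sub_relu_sub (s t : ℝ) : s - relu (s - t) = min s t := by
  unfold relu
  rcases le_total s t with h | h
  · rw [max_eq_right (by linarith), min_eq_left h]; ring
  · rw [max_eq_left (by linarith), min_eq_right h]; ring

lemma add_relu_sub (s t : ℝ) : s + relu (t - s) = max s t := by
  unfold relu
  rcases le_total s t with h | h
  · rw [max_eq_left (by linarith), max_eq_right h]; ring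
  · rw [max_eq_right (by linarith), max_eq_left h]; ring

/-- The content of the register `i` as an affine functional. -/
noncomputable def regAffine (i : Reg d d') : (Reg d d' → ℝ) →ᵃ[ℝ] ℝ :=
  (LinearMap.proj i : (Reg d d' → ℝ) →ₗ[ℝ] ℝ).toAffineMap

@[simp]
lemma regAffine_apply (i : Reg d d') (v : Reg d d' → ℝ) : regAffine i v = v i := rfl

/-- The input token as an affine function of the registers. -/
noncomputable def inputAffine (d d' : ℕ) : (Reg d d' → ℝ) →ᵃ[ℝ] Token d :=
  ((WithLp.linearEquiv 2 ℝ (Fin d → ℝ)).symm.toLinearMap.comp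
    (LinearMap.funLeft ℝ ℝ Sum.inl)).toAffineMap

lemma inputAffine_apply (v : Reg d d' → ℝ) (x : Token d) (h : ∀ i, v (.inl i) = x i) :
    inputAffine d d' v = x := by
  ext i
  exact h i

lemma Computes.set_const (hd' : 0 < d') {G : Reg d d' → Token d → Measure (Token d) → ℝ}
    (hG : Computes G) (i₀ : Reg d d') (c : ℝ) : Computes (Function.update G i₀ fun _ _ => c) := by
  simpa using hG.update_relu hd' (Nat.zero_le _) i₀ (AffineMap.const ℝ _ c) Fin.elim0 Fin.elim0

/-- Updating the first auxiliary register by the minimum with an atom. -/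
lemma Computes.min_atom (hd' : 0 < d') {G : Reg d d' → Token d → Measure (Token d) → ℝ}
    (hG : Computes G) (hX : ∀ i x μ, G (.inl i) x μ = x i)
    {a : Token d × Measure (Token d) → ℝ} (ha : a ∈ atoms d d') :
    ∃ G', Computes G' ∧ (∀ i, G' (.inl i) = G (.inl i)) ∧
      (∀ j, G' (.inr (.inl j)) = G (.inr (.inl j))) ∧
      G' (.inr (.inr 0)) = fun x μ => min (G (.inr (.inr 0)) x μ) (a (x, μ)) := by
  obtain ⟨A, c, n, b, rfl⟩ := ha
  -- The second auxiliary register receives `1 - n * ∑ relu (x k - b k)`, then its rectification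
  -- (the bump), then `d'` times the mean is added. Finally the atom enters the running minimum.
  have h1 := hG.update_relu hd' (r := d) (by omega) (.inr (.inr 1)) (AffineMap.const ℝ _ 1)
    (fun k => regAffine (.inl k) - AffineMap.const ℝ _ (b k)) (fun _ => -n)
  have h2 := h1.update_relu hd' (r := 1) (by omega) (.inr (.inr 1)) (AffineMap.const ℝ _ 0)
    (fun _ => regAffine (.inr (.inr 1))) (fun _ => 1)
  have h3 := h2.update_mean hd' (.inr (.inr 1))
  have h4 := h3.update_relu hd' (r := 1) (by omega) (.inr (.inr 0)) (regAffine (.inr (.inr 0)))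
    (fun _ => regAffine (.inr (.inr 0)) -
      (A.comp (inputAffine d d') + c • regAffine (.inr (.inr 1)))) (fun _ => -1)
  refine ⟨_, h4, fun i => ?_, fun j => ?_, ?_⟩
  · simp
  · simp
  · ext x μ
    rw [Function.update_self, ← sub_relu_sub]
    simp only [AffineMap.comp_apply, AffineMap.coe_sub, AffineMap.coe_add, AffineMap.coe_smul,
      Pi.sub_apply, Pi.add_apply, Pi.smul_apply, AffineMap.const_apply, regAffine_apply,
      Fin.sum_univ_one, zero_add, one_mul, neg_mul, smul_eq_mul, Function.update_self]
    rw [inputAffine_apply _ x fun i => by simp [hX]]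
    simp [hX, orthantBump, sub_eq_add_neg]

/-- Each atom overwrites the scratch register of the previous one, and the input registers stay
intact for the next. -/
lemma Computes.exists_minOf (hd' : 0 < d') {G : Reg d d' → Token d → Measure (Token d) → ℝ}
    (hG : Computes G) (hX : ∀ i x μ, G (.inl i) x μ = x i)
    {f : Token d × Measure (Token d) → ℝ} (hf : MinOf (atoms d d') f) :
    ∃ G', Computes G' ∧ (∀ i, G' (.inl i) = G (.inl i)) ∧
      (∀ j, G' (.inr (.inl j)) = G (.inr (.inl j))) ∧
      G' (.inr (.inr 0)) = fun x μ => f (x, μ) := by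
  induction hf with
  | const c => exact ⟨_, hG.set_const hd' (.inr (.inr 0)) c, by simp, by simp, by simp⟩
  | min _ ha ih =>
    obtain ⟨G₁, h₁, hX₁, hS₁, hM₁⟩ := ih
    obtain ⟨G₂, h₂, hX₂, hS₂, hM₂⟩ := h₁.min_atom hd' (fun i x μ => by rw [hX₁, hX]) ha
    exact ⟨G₂, h₂, fun i => (hX₂ i).trans (hX₁ i), fun j => (hS₂ j).trans (hS₁ j), by
      rw [hM₂, hM₁]⟩

/-- Output register `j` is the running maximum; every minimum is computed afresh in the same
auxiliary register. -/
lemma Computes.exists_maxMinOf (hd' : 0 < d') {G : Reg d d' → Token d → Measure (Token d) → ℝ}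
    (hG : Computes G) (hX : ∀ i x μ, G (.inl i) x μ = x i) (j : Fin d')
    {g : Token d × Measure (Token d) → ℝ} (hg : MaxMinOf (atoms d d') g) :
    ∃ G', Computes G' ∧ (∀ i, G' (.inl i) = G (.inl i)) ∧
      (∀ k, k ≠ j → G' (.inr (.inl k)) = G (.inr (.inl k))) ∧
      G' (.inr (.inl j)) = fun x μ => g (x, μ) := by
  induction hg with
  | const c =>
    exact ⟨_, hG.set_const hd' (.inr (.inl j)) c, by simp, fun k hk => by simp [hk], by simp⟩
  | max _ hf ih =>
    obtain ⟨G₁, h₁, hX₁, hS₁, hj₁⟩ := ih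
    obtain ⟨G₂, h₂, hX₂, hS₂, hM₂⟩ := h₁.exists_minOf hd' (fun i x μ => by rw [hX₁, hX]) hf
    refine ⟨_, h₂.update_relu hd' (r := 1) (by omega) (.inr (.inl j)) (regAffine (.inr (.inl j)))
      (fun _ => regAffine (.inr (.inr 0)) - regAffine (.inr (.inl j))) (fun _ => 1),
      fun i => ?_, fun k hk => ?_, ?_⟩
    · simp [hX₂, hX₁]
    · simp [hk, hS₂, hS₁ k hk]
    · ext x μ
      rw [Function.update_self]
      refine Eq.trans ?_ (add_relu_sub _ _)
      simp [hS₂, hj₁, hM₂]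

lemma exists_computes_maxMinOf (hd' : 0 < d') (g : Fin d' → Token d × Measure (Token d) → ℝ)
    (hg : ∀ j, MaxMinOf (atoms d d') (g j)) :
    ∃ G : Reg d d' → Token d → Measure (Token d) → ℝ,
      Computes G ∧ ∀ j x μ, G (.inr (.inl j)) x μ = g j (x, μ) := by
  have key : ∀ t : Finset (Fin d'), ∃ G : Reg d d' → Token d → Measure (Token d) → ℝ,
      Computes G ∧ (∀ i x μ, G (.inl i) x μ = x i) ∧
        ∀ j ∈ t, ∀ x μ, G (.inr (.inl j)) x μ = g j (x, μ) := by
    intro t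
    induction t using Finset.induction_on with
    | empty => exact ⟨_, computes_init d d', by simp, by simp⟩
    | insert j t hj ih =>
      obtain ⟨G, hG, hX, hS⟩ := ih
      obtain ⟨G₁, h₁, hX₁, hS₁, hj₁⟩ := hG.exists_maxMinOf hd' hX j (hg j)
      refine ⟨G₁, h₁, fun i x μ => by rw [hX₁, hX], fun k hk x μ => ?_⟩
      by_cases hkj : k = j
      · subst hkj
        rw [hj₁]
      · rw [hS₁ k hkj, hS k (Finset.mem_of_mem_insert_of_ne hk hkj)]
  obtain ⟨G, hG, -, hS⟩ := key Finset.univ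
  exact ⟨G, hG, fun j => hS j (Finset.mem_univ j)⟩

end Registers

/-! ### Conclusion -/

lemma norm_le_of_abs_le {n : ℕ} (hn : 0 < n) {ε : ℝ} (hε : 0 ≤ ε) (v : Token n)
    (h : ∀ j, |v j| ≤ ε / n) : ‖v‖ ≤ ε := by
  have hn' : (0 : ℝ) < n := by exact_mod_cast hn
  rw [EuclideanSpace.norm_eq, Real.sqrt_le_left hε]
  calc ∑ j, ‖v j‖ ^ 2 ≤ ∑ _j : Fin n, (ε / n) ^ 2 :=
        Finset.sum_le_sum fun j _ => pow_le_pow_left₀ (norm_nonneg _) (h j) 2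
    _ = ε ^ 2 / n := by
        rw [Finset.sum_const, Finset.card_univ, Fintype.card_fin, nsmul_eq_mul]
        field_simp
    _ ≤ ε ^ 2 := div_le_self (sq_nonneg _) (by exact_mod_cast hn)

end SlicedReLU

theorem mainTheorem2 (d d' : ℕ) :
    ∃ w : ℕ, ∀ Ω : Set (EuclideanSpace ℝ (Fin d)), IsCompact Ω →
      ∀ Λ : Ω × ProbabilityMeasure Ω → EuclideanSpace ℝ (Fin d'), Continuous Λ →
        ∀ ε : ℝ, 0 < ε →
          ∃ (L : ℕ) (T : SlicedReLU.Transformer 1 d' L d d'),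
            T.InputDimLE (d + 3 * d') ∧
            T.HiddenWidthLE w ∧
            ∀ (x : Ω) (μ : ProbabilityMeasure Ω),
              T.WellDefinedAt (x : EuclideanSpace ℝ (Fin d))
                ((μ : Measure Ω).map Subtype.val) ∧
              ‖T.eval (x : EuclideanSpace ℝ (Fin d)) ((μ : Measure Ω).map Subtype.val)
                - Λ (x, μ)‖ ≤ ε := by
  refine ⟨SlicedReLU.widthBound d d', fun Ω hΩ Λ hΛ ε hε => ?_⟩
  rcases Nat.eq_zero_or_pos d' with rfl | hd'
  -- For `d' = 0` the two auxiliary registers would exceed the allowed dimension `d`, but the target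
  -- space is a point and there are no heads to normalize.
  · refine ⟨1, .single (SlicedReLU.meanLayer 0 0 0 (.out 0)), Nat.le_add_right _ _, trivial,
      fun x μ => ⟨fun h => h.elim0, ?_⟩⟩
    rw [Subsingleton.elim (SlicedReLU.Transformer.eval _ _ _ - Λ (x, μ)) 0, norm_zero]
    exact hε.le
  · have := isCompact_iff_compactSpace.1 hΩ
    have hκ : (d' : ℝ) ≠ 0 := by exact_mod_cast hd'.ne'
    choose g hg hgΛ using fun j : Fin d' =>
      SlicedReLU.exists_maxMinOf_near (SlicedReLU.continuous_atoms (κ := d'))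
        (SlicedReLU.atoms_separate hκ hΩ.measurableSet) (f := fun z => Λ z j) (by fun_prop)
        (ε := ε / d') (by positivity)
    obtain ⟨G, hG, hGg⟩ := SlicedReLU.exists_computes_maxMinOf hd' g hg
    obtain ⟨L, T, hin, hw, hT⟩ := hG.exists_transformer hd'
    refine ⟨L, T, hin, hw, fun x μ => ?_⟩
    obtain ⟨h1, h2⟩ := hT _ (SlicedReLU.isProbabilityMeasure_map_val μ) x
    refine ⟨h1, SlicedReLU.norm_le_of_abs_le hd' hε.le _ fun j => ?_⟩
    rw [PiLp.sub_apply, h2, hGg]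
    exact hgΛ j (x, μ)
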